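/- Let $\Phi=\{\varphi_a\}_{a\in\mathcal A}$ be a countable (finite or infinite) family of similarities of $\mathbb R$, $\varphi_a(x)=r_a x+t_a$ with $r_a,t_a\in\mathbb R$ and $0<|r_a|<1$, that is uniformly contracting, i.e. $\sup_{a\in\mathcal A}|r_a|<1$, and non-trivial, i.e. the maps $\varphi_a$ do not all share a common fixed point. Let $\mathbf p=(p_a)_{a\in\mathcal A}$ be a probability vector, i.e. $p_a>0$ for all $a$ and $\sum_{a\in\mathcal A}p_a=1$, and assume that $\sum_{a\in\mathcal A}p_a|r_a|^{-\tau}<\infty$ for some $\tau>0$. Let $\mu$ be the stationary measure for $\Phi$ and $\mathbf p$, i.e. the Borel probability measure on $\mathbb R$ satisfying $\mu=\sum_{a\in\mathcal A}p_a\,\varphi_a\mu$, where $\varphi_a\mu$ is the push-forward of $\mu$ under $\varphi_a$ (under these assumptions there is at most one such measure, and there is one whenever the $\varphi_a$ all map a common compact interval into itself). Write $\widehat\mu(\xi)=\int_{\mathbb R}e^{-2\pi i\xi x}\,d\mu(x)$. Then for every $\gamma>0$ there exist $\eta,C>0$ such that for all $T>0$ the set $\{\xi\in[-T,T]:|\widehat\mu(\xi)|\ge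 T^{-\eta}\}$ can be covered by at most $C\,T^{\gamma}$ intervals of length $1$. -/

import Mathlib

open MeasureTheory

/-- A family of self-maps of the line is a countable iterated function system (CIFS) when its index
set is countable and its maps are uniformly contracting, i.e. the supremum over all maps of their
Lipschitz constants is strictly less than one. -/
def IsCIFS {ι : Type*} (φ : ι → ℝ → ℝ) : Prop :=
  Countable ι ∧ ∃ ρ : ℝ, ρ < 1 ∧ ∀ (a : ι) (x y : ℝ), |φ a x - φ a y| ≤ ρ * |x - y|

/-- The map `f` of the line is a similarity with (signed) ratio `r` and translation `t`. -/
def IsSimilarityWith (f : ℝ → ℝ) (r t : ℝ) : Prop :=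
  0 < |r| ∧ |r| < 1 ∧ ∀ x : ℝ, f x = r * x + t

/-- The system is non-trivial: its maps do not all share a common fixed point. -/
def IsNontrivialIFS {ι : Type*} (φ : ι → ℝ → ℝ) : Prop :=
  ¬ ∃ x : ℝ, ∀ a : ι, φ a x = x

/-- A probability vector with strictly positive weights. -/
def IsProbabilityVector {ι : Type*} (p : ι → ℝ) : Prop :=
  (∀ a : ι, 0 < p a) ∧ HasSum p 1

/-- `μ` is the stationary measure of `φ` and `p`: a Borel probability measure that equals the
weighted sum of its push-forwards, `μ = ∑ a, p a • (φ a) μ`. -/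
def IsStationaryMeasure {ι : Type*} (φ : ι → ℝ → ℝ) (p : ι → ℝ) (μ : Measure ℝ) : Prop :=
  IsProbabilityMeasure μ ∧
    μ = Measure.sum (fun a : ι => ENNReal.ofReal (p a) • Measure.map (φ a) μ)

/-- The Fourier transform `ξ ↦ ∫ exp (-2 π i ξ x) dμ(x)` of a measure on the line. -/
noncomputable def measureFourier (μ : Measure ℝ) (ξ : ℝ) : ℂ :=
  ∫ x : ℝ, Complex.exp (-2 * (Real.pi : ℂ) * Complex.I * (ξ : ℂ) * (x : ℂ)) ∂μ

/-- `S` can be covered by at most `B` intervals of length one (`B` a real number). -/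
def CoveredByUnitIntervals (S : Set ℝ) (B : ℝ) : Prop :=
  ∃ s : Finset ℝ, (s.card : ℝ) ≤ B ∧ S ⊆ ⋃ c ∈ s, Set.Icc c (c + 1)

/-! ### Sums over unit cells and their behaviour under scaling. -/

/-- The sum over the unit cells `{x | round x = k}` of the supremum of `F` over the part of the cell
that lies in `[-T, T]`. -/
noncomputable def cellSum (F : ℝ → ENNReal) (T : ℝ) : ENNReal :=
  ∑' k : ℤ, ⨆ x : ℝ, ⨆ _ : round x = k ∧ |x| ≤ T, F x

theorem cellSum_mono {F G : ℝ → ENNReal} {S T : ℝ} (hFG : ∀ x, F x ≤ G x) (hST : S ≤ T) :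
    cellSum F S ≤ cellSum G T := by
  refine ENNReal.tsum_le_tsum fun k => iSup_le fun x => iSup_le fun hx => ?_
  exact (hFG x).trans (le_iSup₂_of_le x ⟨hx.1, hx.2.trans hST⟩ le_rfl)

theorem cellSum_const_mul_le (c : ENNReal) (F : ℝ → ENNReal) (T : ℝ) :
    cellSum (fun x => c * F x) T ≤ c * cellSum F T := by
  unfold cellSum
  rw [← ENNReal.tsum_mul_left]
  refine ENNReal.tsum_le_tsum fun k => iSup₂_le fun x hx => ?_
  exact mul_le_mul_right (le_iSup₂_of_le x hx le_rfl) c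

theorem cellSum_add_le (F G : ℝ → ENNReal) (T : ℝ) :
    cellSum (fun x => F x + G x) T ≤ cellSum F T + cellSum G T := by
  unfold cellSum
  rw [← ENNReal.tsum_add]
  refine ENNReal.tsum_le_tsum fun k => iSup₂_le fun x hx => ?_
  exact add_le_add (le_iSup₂_of_le x hx le_rfl) (le_iSup₂_of_le x hx le_rfl)

theorem cellSum_tsum_le {J : Type*} (F : J → ℝ → ENNReal) (T : ℝ) :
    cellSum (fun x => ∑' j, F j x) T ≤ ∑' j, cellSum (F j) T := by
  unfold cellSum
  rw [ENNReal.tsum_comm]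
  refine ENNReal.tsum_le_tsum fun k => iSup₂_le fun x hx => ?_
  exact ENNReal.tsum_le_tsum fun j => le_iSup₂_of_le x hx le_rfl

theorem cellSum_lt_top {F : ℝ → ENNReal} {B : ENNReal} (hB : B < ⊤) (hF : ∀ x, F x ≤ B) (T : ℝ) :
    cellSum F T < ⊤ := by
  obtain ⟨N, hN⟩ := exists_int_gt (T + 1)
  unfold cellSum
  rw [tsum_eq_sum (s := Finset.Icc (-N) N)]
  · refine ENNReal.sum_lt_top.2 fun k _ => lt_of_le_of_lt (iSup₂_le fun x _ => hF x) hB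
  · intro k hk
    refine le_antisymm (iSup₂_le fun x hx => ?_) bot_le
    exfalso
    apply hk
    have h1 := abs_le.1 (abs_sub_round x)
    have h2 := abs_le.1 hx.2
    rw [hx.1] at h1
    rw [Finset.mem_Icc]
    constructor
    · have : (-N : ℝ) ≤ k := by linarith
      exact_mod_cast this
    · have : (k : ℝ) ≤ N := by linarith
      exact_mod_cast this

/-- The number of integers at distance at most `b` from `c` is at most `2 b + 1`. -/
theorem tsum_int_near_le (c b : ℝ) (hb : 0 ≤ b) :
    ∑' k : ℤ, (if |(k : ℝ) - c| ≤ b then (1 : ENNReal) else 0) ≤ ENNReal.ofReal (2 * b + 1) := by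
  have hmem : ∀ k : ℤ, |(k : ℝ) - c| ≤ b ↔ k ∈ Finset.Icc ⌈c - b⌉ ⌊c + b⌋ := by
    intro k
    rw [Finset.mem_Icc, Int.ceil_le, Int.le_floor, abs_le]
    constructor
    · rintro ⟨h1, h2⟩; constructor <;> linarith
    · rintro ⟨h1, h2⟩; constructor <;> linarith
  rw [tsum_eq_sum (s := Finset.Icc ⌈c - b⌉ ⌊c + b⌋)]
  · rw [Finset.sum_congr rfl fun k hk => if_pos ((hmem k).2 hk)]
    rw [Finset.sum_const, Int.card_Icc, nsmul_eq_mul, mul_one]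
    rw [← ENNReal.ofReal_natCast]
    apply ENNReal.ofReal_le_ofReal
    have h1 := Int.floor_le (c + b)
    have h2 := Int.le_ceil (c - b)
    have h3 : ((⌊c + b⌋ + 1 - ⌈c - b⌉).toNat : ℝ)
        = ((max (⌊c + b⌋ + 1 - ⌈c - b⌉) 0 : ℤ) : ℝ) := by
      rw [← Int.toNat_eq_max]; rfl
    rw [h3]
    push_cast
    apply max_le <;> linarith
  · intro k hk
    exact if_neg fun h => hk ((hmem k).1 h)

/-- Contracting the line by `R` sends at most `1 + 2 δ (1 + 1 / R)` cells to a given cell, if one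
only looks at points that are `δ`-close to the integers before and after the contraction. -/
theorem cellSum_comp_mul_le (F : ℝ → ENNReal) {R δ : ℝ} (hR : 0 < R) (hδ : 0 ≤ δ) (T : ℝ) :
    cellSum (fun x => if |x - round x| ≤ δ ∧ |R * x - round (R * x)| ≤ δ then F (R * x) else 0) T
      ≤ ENNReal.ofReal (1 + 2 * δ * (1 + 1 / R)) * cellSum F (R * T) := by
  set S : ℤ → ENNReal := fun i => ⨆ y : ℝ, ⨆ _ : round y = i ∧ |y| ≤ R * T, F y with hS
  have hb : 0 ≤ δ * (1 + 1 / R) := by positivity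
  calc _ ≤ ∑' k : ℤ, ∑' i : ℤ,
        (if |(k : ℝ) - i / R| ≤ δ * (1 + 1 / R) then (1 : ENNReal) else 0) * S i := by
        refine ENNReal.tsum_le_tsum fun k => iSup₂_le fun x hx => ?_
        dsimp only
        split_ifs with h
        · refine le_trans ?_ (ENNReal.le_tsum (round (R * x)))
          -- Nearness to integers on both sides pins `k` to a short window around `i / R`, with `i =
          -- round (R * x)`; the integers in that window are then counted.
          have hk : |(k : ℝ) - round (R * x) / R| ≤ δ * (1 + 1 / R) := by
            have e : (k : ℝ) - round (R * x) / R
                = -(x - round x) + (R * x - round (R * x)) / R := by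
              rw [hx.1]; field_simp; ring
            rw [e]
            refine (abs_add_le _ _).trans ?_
            rw [abs_neg, abs_div, abs_of_pos hR]
            have : |R * x - round (R * x)| / R ≤ δ / R := by gcongr; exact h.2
            calc _ ≤ δ + δ / R := add_le_add h.1 this
              _ = _ := by ring
          rw [if_pos hk, one_mul]
          refine le_iSup₂_of_le (R * x) ⟨rfl, ?_⟩ le_rfl
          rw [abs_mul, abs_of_pos hR]
          gcongr
          exact hx.2
        · exact bot_le
    _ = ∑' i : ℤ, (∑' k : ℤ,
        (if |(k : ℝ) - i / R| ≤ δ * (1 + 1 / R) then (1 : ENNReal) else 0)) * S i := by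
        rw [ENNReal.tsum_comm]
        simp_rw [ENNReal.tsum_mul_right]
    _ ≤ ∑' i : ℤ, ENNReal.ofReal (1 + 2 * δ * (1 + 1 / R)) * S i := by
        refine ENNReal.tsum_le_tsum fun i => ?_
        gcongr
        refine (tsum_int_near_le _ _ hb).trans (le_of_eq ?_)
        congr 1; ring
    _ = _ := by rw [ENNReal.tsum_mul_left]; rfl

/-- The case `δ = 1 / 2`, where both nearness conditions are vacuous. -/
theorem cellSum_comp_mul_le' (F : ℝ → ENNReal) {R : ℝ} (hR : 0 < R) (T : ℝ) :
    cellSum (fun x => F (R * x)) T ≤ ENNReal.ofReal (2 + 1 / R) * cellSum F (R * T) := by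
  have h := cellSum_comp_mul_le F hR (δ := 1 / 2) (by norm_num) T
  simp only [abs_sub_round, true_and, if_true] at h
  convert h using 3
  ring

/-! ### Scaling of weighted cell sums. -/

/-- The weight equal to `1` at the points that are `ε`-close to the integers and to `L` elsewhere. -/
noncomputable def latticeWeight (ε : ℝ) (L : ENNReal) (x : ℝ) : ENNReal :=
  if |x - round x| ≤ ε then 1 else L

theorem latticeWeight_le {ε : ℝ} {L : ENNReal} (hL : 1 ≤ L) (x : ℝ) : latticeWeight ε L x ≤ L := by
  unfold latticeWeight; split_ifs <;> simp [hL]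

theorem one_le_latticeWeight {ε : ℝ} {L : ENNReal} (hL : 1 ≤ L) (x : ℝ) :
    1 ≤ latticeWeight ε L x := by
  unfold latticeWeight; split_ifs <;> simp [hL]

/-- The crude bound, which gives up the full factor `L`; it serves for very small ratios. -/
theorem cellSum_weight_comp_mul_le {ε : ℝ} {L : ENNReal} (hL : 1 ≤ L) (H F : ℝ → ENNReal)
    (hH : ∀ x, H x ≤ 1) {R : ℝ} (hR : 0 < R) (T : ℝ) :
    cellSum (fun x => latticeWeight ε L x * H x * F (R * x)) T
      ≤ L * ENNReal.ofReal (2 + 1 / R) *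
        cellSum (fun x => latticeWeight ε L x * F x) (R * T) := by
  calc _ ≤ cellSum (fun x => L * (latticeWeight ε L (R * x) * F (R * x))) T := by
        refine cellSum_mono (fun x => ?_) le_rfl
        calc _ ≤ L * 1 * (1 * F (R * x)) := by
              rw [one_mul]; gcongr; exacts [latticeWeight_le hL x, hH x]
          _ ≤ L * (latticeWeight ε L (R * x) * F (R * x)) := by
              rw [mul_one]; gcongr; exact one_le_latticeWeight hL _
    _ ≤ _ := by
        refine (cellSum_const_mul_le _ _ _).trans ?_
        rw [mul_assoc]
        gcongr
        exact cellSum_comp_mul_le' (fun x => latticeWeight ε L x * F x) hR T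

/-- Three cases. If `x` and `R * x` are both near integers, few cells meet; if only `R * x` is far,
its weight gains `L⁻¹`; if `x` is far, the weight costs `L` but `H` gains `κ`. -/
theorem cellSum_weight_comp_mul_le_of_far {ε : ℝ} (hε : 0 ≤ ε) {L κ : ENNReal} (hL : 1 ≤ L)
    (hL' : L ≠ ⊤) (H F : ℝ → ENNReal) (hH : ∀ x, H x ≤ 1)
    (hκ : ∀ x : ℝ, ε < |x - round x| → H x ≤ κ) {R : ℝ} (hR : 0 < R) (T : ℝ) :
    cellSum (fun x => latticeWeight ε L x * H x * F (R * x)) T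
      ≤ (ENNReal.ofReal (1 + 2 * ε * (1 + 1 / R))
          + (L⁻¹ + L * κ) * ENNReal.ofReal (2 + 1 / R)) *
        cellSum (fun x => latticeWeight ε L x * F x) (R * T) := by
  set G : ℝ → ENNReal := fun x => latticeWeight ε L x * F x with hG
  have hL0 : L ≠ 0 := (zero_lt_one.trans_le hL).ne'
  calc _ ≤ cellSum (fun x =>
        (if |x - round x| ≤ ε ∧ |R * x - round (R * x)| ≤ ε then G (R * x) else 0)
          + (L⁻¹ + L * κ) * G (R * x)) T := by
        refine cellSum_mono (fun x => ?_) le_rfl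
        by_cases h1 : |x - round x| ≤ ε
        · have e1 : latticeWeight ε L x = 1 := if_pos h1
          rw [e1, one_mul]
          by_cases h2 : |R * x - round (R * x)| ≤ ε
          · rw [if_pos ⟨h1, h2⟩]
            refine le_add_right ?_
            have e2 : latticeWeight ε L (R * x) = 1 := if_pos h2
            simp only [hG, e2]
            gcongr
            exact hH x
          · refine le_add_left ?_
            have e2 : latticeWeight ε L (R * x) = L := if_neg h2
            simp only [hG, e2]
            calc H x * F (R * x) ≤ 1 * F (R * x) := by gcongr; exact hH x
              _ = L⁻¹ * (L * F (R * x)) := by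
                rw [← mul_assoc, ENNReal.inv_mul_cancel hL0 hL']
              _ ≤ _ := by gcongr; exact le_self_add
        · refine le_add_left ?_
          have e1 : latticeWeight ε L x = L := if_neg h1
          rw [e1]
          calc L * H x * F (R * x) ≤ L * κ * (1 * F (R * x)) := by
                rw [one_mul]; gcongr; exact hκ x (not_le.1 h1)
            _ ≤ (L⁻¹ + L * κ) * G (R * x) := by
                simp only [hG]
                gcongr
                · exact le_add_self
                · exact one_le_latticeWeight hL _
    _ ≤ _ := by
        refine (cellSum_add_le _ _ _).trans ?_
        rw [add_mul]
        refine add_le_add (cellSum_comp_mul_le G hR hε T) ?_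
        refine (cellSum_const_mul_le _ _ _).trans ?_
        rw [mul_assoc]
        gcongr
        exact cellSum_comp_mul_le' G hR T

/-! ### Hölder's inequality and one renormalisation step. -/

/-- Hölder's inequality for the `q`-th power of a weighted sum, with auxiliary weights `c`. -/
theorem tsum_mul_pow_le {J : Type*} (P c y : J → ENNReal) (hc : ∀ j, c j ≠ 0)
    (hc' : ∀ j, c j ≠ ⊤) {q : ℕ} (hq : 1 ≤ q) :
    (∑' j, P j * y j) ^ q
      ≤ (∑' j, P j * c j ^ (1 / q : ℝ)) ^ (q - 1) *
        ∑' j, P j * c j ^ (1 / q : ℝ) * (c j)⁻¹ * y j ^ q := by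
  have hq0 : (q : ℝ) ≠ 0 := by positivity
  -- The exponent `1 / q` is the balanced one: when the `j`-th term later loses a factor `c j`, the
  -- `(c j)⁻¹` cancels it and the total loss is `(∑ w j) ^ q`.
  set w : J → ENNReal := fun j => P j * c j ^ (1 / q : ℝ) with hw
  set z : J → ENNReal := fun j => (c j ^ (1 / q : ℝ))⁻¹ * y j with hz
  have hd0 : ∀ j, c j ^ (1 / q : ℝ) ≠ 0 := fun j => by
    simp [ENNReal.rpow_eq_zero_iff, hc j, hc' j]
  have hdt : ∀ j, c j ^ (1 / q : ℝ) ≠ ⊤ := fun j => by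
    simp [ENNReal.rpow_eq_top_iff, hc j, hc' j]
  have e1 : ∀ j, P j * y j = w j * z j := fun j => by
    simp only [hw, hz]
    rw [mul_assoc, ← mul_assoc (c j ^ (1 / q : ℝ)), ENNReal.mul_inv_cancel (hd0 j) (hdt j), one_mul]
  have e2 : ∀ j, w j * (c j)⁻¹ * y j ^ q = w j * z j ^ (q : ℝ) := fun j => by
    simp only [hz]
    rw [ENNReal.rpow_natCast, mul_pow, ← ENNReal.inv_pow, ← ENNReal.rpow_natCast (c j ^ _),
      ← ENNReal.rpow_mul, one_div_mul_cancel hq0, ENNReal.rpow_one, mul_assoc]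
  have key : ∑' j, w j * z j
      ≤ (∑' j, w j) ^ (1 - (q : ℝ)⁻¹) * (∑' j, w j * z j ^ (q : ℝ)) ^ (q : ℝ)⁻¹ := by
    have hq1 : (1 : ℝ) ≤ q := by exact_mod_cast hq
    rw [ENNReal.tsum_eq_iSup_sum]
    refine iSup_le fun s => ?_
    refine (ENNReal.inner_le_weight_mul_Lp_of_nonneg s hq1 w z).trans ?_
    gcongr
    · have : (q : ℝ)⁻¹ ≤ 1 := inv_le_one_of_one_le₀ hq1
      linarith
    · exact ENNReal.sum_le_tsum s
    · exact ENNReal.sum_le_tsum s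
  simp_rw [e1]
  simp_rw [hw] at e2
  simp_rw [e2]
  calc (∑' j, w j * z j) ^ q
      ≤ ((∑' j, w j) ^ (1 - (q : ℝ)⁻¹) * (∑' j, w j * z j ^ (q : ℝ)) ^ (q : ℝ)⁻¹) ^ q := by
        gcongr
    _ = _ := by
      rw [mul_pow, ← ENNReal.rpow_natCast, ← ENNReal.rpow_mul, ← ENNReal.rpow_natCast (_ ^ (q : ℝ)⁻¹),
        ← ENNReal.rpow_mul, inv_mul_cancel₀ hq0, ENNReal.rpow_one]
      congr 1
      rw [← ENNReal.rpow_natCast]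
      congr 1
      rw [Nat.cast_sub hq, sub_mul, inv_mul_cancel₀ hq0]
      simp

/-- One step of the renormalisation. -/
theorem cellSum_weight_pow_le {J : Type*} (P : J → ENNReal) (R : J → ℝ) (c : J → ENNReal)
    (hc : ∀ j, c j ≠ 0) (hc' : ∀ j, c j ≠ ⊤) {ρ : ℝ} (hρ : ∀ j, R j ≤ ρ) {q : ℕ} (hq : 1 ≤ q)
    (W H f g : ℝ → ENNReal) {T : ℝ} (hT : 0 ≤ T)
    (hg : ∀ x, g x ≤ H x * ∑' j, P j * f (R j * x))
    (hstep : ∀ j, cellSum (fun x => W x * H x ^ q * f (R j * x) ^ q) T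
      ≤ c j * cellSum (fun x => W x * f x ^ q) (R j * T)) :
    cellSum (fun x => W x * g x ^ q) T
      ≤ (∑' j, P j * c j ^ (1 / q : ℝ)) ^ q * cellSum (fun x => W x * f x ^ q) (ρ * T) := by
  set Z := ∑' j, P j * c j ^ (1 / q : ℝ) with hZ
  calc _ ≤ cellSum (fun x => Z ^ (q - 1) * ∑' j, P j * c j ^ (1 / q : ℝ) * (c j)⁻¹ *
          (W x * H x ^ q * f (R j * x) ^ q)) T := by
        refine cellSum_mono (fun x => ?_) le_rfl
        calc W x * g x ^ q ≤ W x * (H x * ∑' j, P j * f (R j * x)) ^ q := by gcongr; exact hg x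
          _ = W x * H x ^ q * (∑' j, P j * f (R j * x)) ^ q := by rw [mul_pow, mul_assoc]
          _ ≤ W x * H x ^ q * (Z ^ (q - 1) *
              ∑' j, P j * c j ^ (1 / q : ℝ) * (c j)⁻¹ * f (R j * x) ^ q) := by
              gcongr
              exact tsum_mul_pow_le P c _ hc hc' hq
          _ = _ := by
              rw [mul_left_comm, ← ENNReal.tsum_mul_left]
              congr 1
              refine tsum_congr fun j => ?_
              ring
    _ ≤ Z ^ (q - 1) * ∑' j, P j * c j ^ (1 / q : ℝ) * (c j)⁻¹ *
          (c j * cellSum (fun x => W x * f x ^ q) (ρ * T)) := by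
        refine (cellSum_const_mul_le _ _ _).trans ?_
        gcongr
        refine (cellSum_tsum_le _ _).trans (ENNReal.tsum_le_tsum fun j => ?_)
        refine (cellSum_const_mul_le _ _ _).trans ?_
        gcongr
        refine (hstep j).trans ?_
        gcongr
        exact cellSum_mono (fun _ => le_rfl) (by gcongr; exact hρ j)
    _ = _ := by
        have : ∀ j, P j * c j ^ (1 / q : ℝ) * (c j)⁻¹ *
            (c j * cellSum (fun x => W x * f x ^ q) (ρ * T))
            = P j * c j ^ (1 / q : ℝ) * cellSum (fun x => W x * f x ^ q) (ρ * T) := fun j => by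
          rw [mul_assoc, ← mul_assoc (c j)⁻¹, ENNReal.inv_mul_cancel (hc j) (hc' j), one_mul]
        simp_rw [this]
        rw [ENNReal.tsum_mul_right, ← hZ, ← mul_assoc, ← pow_succ]
        congr 2
        omega

/-! ### Numerical estimates for the coefficients of the step. -/

theorem abs_cos_pi_mul_le {ε x : ℝ} (hε : 0 ≤ ε) (hx : ε ≤ |x - round x|) :
    |Real.cos (Real.pi * x)| ≤ Real.cos (Real.pi * ε) := by
  have h1 : |Real.cos (Real.pi * x)| = |Real.cos (Real.pi * (x - round x))| := by
    have : Real.pi * x = Real.pi * (x - round x) + (round x : ℤ) * Real.pi := by ring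
    rw [this, Real.cos_add_int_mul_pi, abs_mul]
    simp
  have h2 := abs_sub_round x
  have hpi := Real.pi_pos
  rw [h1, ← Real.cos_abs, abs_mul, abs_of_pos hpi, abs_of_nonneg]
  · apply Real.cos_le_cos_of_nonneg_of_le_pi <;> nlinarith
  · apply Real.cos_nonneg_of_neg_pi_div_two_le_of_le <;> nlinarith [abs_nonneg (x - round x)]

/-- For the crude coefficient `c = 9 / (a * R ^ 2)`, `c ^ s - 1` is at most `s * log c * c ^ s`,
which is of order `s * R ^ (-τ / 2)`. Against `R ^ (-τ)` this leaves a factor `R ^ (τ / 2)`, small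
below the threshold. -/
theorem exists_rpow_le_one_add {a τ K : ℝ} (ha : 0 < a) (ha1 : a ≤ 1) (hτ : 0 < τ) (hK : 0 ≤ K) :
    ∃ ρ : ℝ, 0 < ρ ∧ ρ ≤ 1 ∧ ∀ s : ℝ, 0 < s → s ≤ τ / 8 → ∀ R : ℝ, 0 < R → R < ρ →
      (9 / a * (R ^ 2)⁻¹) ^ s ≤ 1 + s * (a / (K + 1) * R ^ (-τ)) := by
  -- `D` is the constant in `log c * c ^ s ≤ D * R ^ (-τ / 2)`, and `y` is the bound on `R ^ (τ /
  -- 2)` for which `D * y = a / (K + 1)`.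
  set D : ℝ := 8 / τ * (9 / a) ^ (τ / 4) with hD
  have hDpos : 0 < D := by positivity
  set y : ℝ := a / (K + 1) / D with hy
  have hypos : 0 < y := by positivity
  refine ⟨min 1 (y ^ (2 / τ)), by positivity, min_le_left _ _, ?_⟩
  intro s hs hsτ R hR hRρ
  have hR1 : R < 1 := hRρ.trans_le (min_le_left _ _)
  have hRy : R ^ (τ / 2) ≤ y := by
    have h : R ≤ y ^ (2 / τ) := hRρ.le.trans (min_le_right _ _)
    calc R ^ (τ / 2) ≤ (y ^ (2 / τ)) ^ (τ / 2) := by gcongr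
      _ = y := by
        rw [← Real.rpow_mul hypos.le]
        have : 2 / τ * (τ / 2) = 1 := by field_simp
        rw [this, Real.rpow_one]
  set c : ℝ := 9 / a * (R ^ 2)⁻¹ with hc
  have hc1 : 1 ≤ c := by
    have h1 : 1 ≤ 9 / a := by rw [le_div_iff₀ ha]; linarith
    have h2 : 1 ≤ (R ^ 2)⁻¹ := by
      rw [one_le_inv₀ (by positivity)]; exact pow_le_one₀ hR.le hR1.le
    nlinarith
  have hc0 : 0 < c := by linarith
  -- This is `1 - u ≤ exp (-u)` multiplied by `exp u`, with `u = s * log c`.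
  have h1 : c ^ s ≤ 1 + s * Real.log c * c ^ s := by
    have := Real.add_one_le_exp (-(Real.log c * s))
    rw [Real.rpow_def_of_pos hc0]
    have h3 : Real.exp (-(Real.log c * s)) * Real.exp (Real.log c * s) = 1 := by
      rw [← Real.exp_add]; simp
    nlinarith [Real.exp_pos (Real.log c * s)]
  have h2 : Real.log c ≤ c ^ (τ / 8) / (τ / 8) := Real.log_le_rpow_div hc0.le (by positivity)
  have h3 : c ^ s ≤ c ^ (τ / 8) := Real.rpow_le_rpow_of_exponent_le hc1 hsτ
  have h4 : c ^ (τ / 8) / (τ / 8) * c ^ (τ / 8) = D * R ^ (-(τ / 2)) := by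
    have e : c ^ (τ / 8) * c ^ (τ / 8) = (9 / a) ^ (τ / 4) * R ^ (-(τ / 2)) := by
      rw [← Real.rpow_add hc0, hc, Real.mul_rpow (by positivity) (by positivity),
        ← Real.rpow_natCast, ← Real.rpow_neg hR.le, ← Real.rpow_mul hR.le]
      congr 2 <;> (push_cast; ring)
    calc _ = 8 / τ * (c ^ (τ / 8) * c ^ (τ / 8)) := by field_simp
      _ = _ := by rw [e, hD]; ring
  have h5 : R ^ (-(τ / 2)) = R ^ (τ / 2) * R ^ (-τ) := by
    rw [← Real.rpow_add hR]; congr 1; ring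
  have hlog : 0 ≤ Real.log c := Real.log_nonneg hc1
  calc c ^ s ≤ 1 + s * (Real.log c * c ^ s) := by linarith
    _ ≤ 1 + s * (c ^ (τ / 8) / (τ / 8) * c ^ (τ / 8)) := by gcongr
    _ = 1 + s * (D * R ^ (τ / 2) * R ^ (-τ)) := by rw [h4, h5]; ring
    _ ≤ 1 + s * (D * y * R ^ (-τ)) := by gcongr
    _ = _ := by rw [hy]; field_simp

/-- With `ε = a / (2 * M)` and `L = M / a`, each of the three errors (extra cells, `L⁻¹`, and `L *
k`) contributes at most `a`. -/
theorem ofReal_far_coefficient_le {a M k R : ℝ} (ha : 0 < a) (hM : 0 < M) (hk : 0 ≤ k)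
    (hkM : k ≤ a ^ 2 / M ^ 2) (hR : 0 < R) (hRM : 2 + 1 / R ≤ M) :
    ENNReal.ofReal (1 + 2 * (a / (2 * M)) * (1 + 1 / R))
        + ((ENNReal.ofReal (M / a))⁻¹ + ENNReal.ofReal (M / a) * ENNReal.ofReal k)
          * ENNReal.ofReal (2 + 1 / R)
      ≤ ENNReal.ofReal (1 + 3 * a) := by
  have hMa : 0 < M / a := by positivity
  rw [← ENNReal.ofReal_inv_of_pos hMa, ← ENNReal.ofReal_mul hMa.le,
    ← ENNReal.ofReal_add (by positivity) (by positivity), ← ENNReal.ofReal_mul (by positivity),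
    ← ENNReal.ofReal_add (by positivity) (by positivity)]
  apply ENNReal.ofReal_le_ofReal
  have h1 : 2 * (a / (2 * M)) * (1 + 1 / R) ≤ a := by
    calc 2 * (a / (2 * M)) * (1 + 1 / R) ≤ 2 * (a / (2 * M)) * M := by gcongr; linarith
      _ = a := by field_simp
  have h2 : ((M / a)⁻¹ + M / a * k) * (2 + 1 / R) ≤ 2 * a := by
    calc ((M / a)⁻¹ + M / a * k) * (2 + 1 / R)
        ≤ ((M / a)⁻¹ + M / a * (a ^ 2 / M ^ 2)) * M := by gcongr
      _ = 2 * a := by field_simp; norm_num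
  linarith

/-- The mean of `c j ^ (1 / q)` is at most `1 + 4 * a / q`: the moment term contributes `K / (K + 1)
* (a / q)`. The `q`-th power is then bounded independently of `q`. -/
theorem tsum_mul_rpow_pow_le {J : Type*} (P : J → ENNReal) (R : J → ℝ) (c : J → ENNReal)
    {a τ K : ℝ} (ha : 0 < a) (hK : 0 ≤ K) (hP : ∑' j, P j ≤ 1)
    (hPR : ∑' j, P j * ENNReal.ofReal (R j ^ (-τ)) ≤ ENNReal.ofReal K) (hR : ∀ j, 0 < R j)
    {q : ℕ} (hq : 1 ≤ q)
    (hc : ∀ j, c j ^ (1 / q : ℝ)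
      ≤ ENNReal.ofReal (1 + 3 * a * (1 / q) + 1 / q * (a / (K + 1) * R j ^ (-τ)))) :
    (∑' j, P j * c j ^ (1 / q : ℝ)) ^ q ≤ ENNReal.ofReal (Real.exp (4 * a)) := by
  have hq0 : (0 : ℝ) < q := by exact_mod_cast hq
  have h1 : ∑' j, P j * c j ^ (1 / q : ℝ) ≤ ENNReal.ofReal (1 + 4 * a / q) := by
    calc ∑' j, P j * c j ^ (1 / q : ℝ)
        ≤ ∑' j, (P j * ENNReal.ofReal (1 + 3 * a * (1 / q)) +
          P j * ENNReal.ofReal (R j ^ (-τ)) * ENNReal.ofReal (1 / q * (a / (K + 1)))) := by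
          refine ENNReal.tsum_le_tsum fun j => ?_
          have hRj : 0 ≤ R j ^ (-τ) := Real.rpow_nonneg (hR j).le _
          rw [mul_assoc (P j), ← mul_add, ← ENNReal.ofReal_mul hRj,
            ← ENNReal.ofReal_add (by positivity) (by positivity)]
          gcongr
          refine (hc j).trans (le_of_eq ?_)
          congr 1; ring
      _ ≤ 1 * ENNReal.ofReal (1 + 3 * a * (1 / q)) +
          ENNReal.ofReal K * ENNReal.ofReal (1 / q * (a / (K + 1))) := by
          rw [ENNReal.tsum_add, ENNReal.tsum_mul_right, ENNReal.tsum_mul_right]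
          gcongr
      _ ≤ _ := by
          rw [one_mul, ← ENNReal.ofReal_mul hK,
            ← ENNReal.ofReal_add (by positivity) (by positivity)]
          apply ENNReal.ofReal_le_ofReal
          have : K * (1 / q * (a / (K + 1))) ≤ a / q := by
            have h : K / (K + 1) ≤ 1 := by rw [div_le_one (by linarith)]; linarith
            calc K * (1 / q * (a / (K + 1))) = K / (K + 1) * (a / q) := by field_simp
              _ ≤ 1 * (a / q) := by gcongr
              _ = _ := one_mul _
          calc _ ≤ 1 + 3 * a * (1 / q) + a / q := by linarith
            _ = _ := by ring
  calc _ ≤ ENNReal.ofReal (1 + 4 * a / q) ^ q := by gcongr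
    _ = ENNReal.ofReal ((1 + 4 * a / q) ^ q) := (ENNReal.ofReal_pow (by positivity) _).symm
    _ ≤ _ := by
      apply ENNReal.ofReal_le_ofReal
      calc (1 + 4 * a / q) ^ q ≤ Real.exp (4 * a / q) ^ q := by
            gcongr; linarith [Real.add_one_le_exp (4 * a / q)]
        _ = Real.exp (4 * a) := by rw [← Real.exp_nat_mul]; congr 1; field_simp

/-! ### Growth of the cell sums from scale to scale. -/

/-- The weighted sum of the suprema of `f ^ q` over the cells grows by an arbitrarily small factor
from one scale to the next when `q` is large. -/
theorem exists_cellSum_weight_pow_le {J : Type*} (P : J → ENNReal) (R : J → ℝ) {ρ τ a : ℝ}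
    (hρ1 : ρ ≤ 1) (hR : ∀ j, 0 < R j) (hRρ : ∀ j, R j ≤ ρ) (hP : ∑' j, P j ≤ 1) (hτ : 0 < τ)
    (hPR : ∑' j, P j * ENNReal.ofReal (R j ^ (-τ)) ≠ ⊤) (f : ℝ → ENNReal)
    (hf : ∀ x, f x ≤ ENNReal.ofReal |Real.cos (Real.pi * x)| * ∑' j, P j * f (R j * x))
    (ha : 0 < a) (ha1 : a ≤ 1) :
    ∃ ε : ℝ, ∃ L : ENNReal, 1 ≤ L ∧ L ≠ ⊤ ∧ ∃ q₀ : ℕ, ∀ q : ℕ, q₀ ≤ q → ∀ T : ℝ, 0 ≤ T →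
      cellSum (fun x => latticeWeight ε L x * f x ^ q) T ≤ ENNReal.ofReal (Real.exp (4 * a)) *
        cellSum (fun x => latticeWeight ε L x * f x ^ q) (ρ * T) := by
  set K : ℝ := (∑' j, P j * ENNReal.ofReal (R j ^ (-τ))).toReal with hK
  have hK0 : 0 ≤ K := ENNReal.toReal_nonneg
  have hPR' : ∑' j, P j * ENNReal.ofReal (R j ^ (-τ)) ≤ ENNReal.ofReal K := by
    rw [hK, ENNReal.ofReal_toReal hPR]
  obtain ⟨ρ₀, hρ₀, hρ₀1, hsmall⟩ := exists_rpow_le_one_add ha ha1 hτ hK0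
  -- `M` bounds `2 + 1 / R j` for all ratios not below `ρ₀`; it determines `ε` and `L`.
  set M : ℝ := 2 + 1 / ρ₀ with hM
  have hM0 : 0 < M := by positivity
  have hM2 : 2 < M := by have : 0 < 1 / ρ₀ := by positivity
                         linarith
  set ε : ℝ := a / (2 * M) with hε
  have hε0 : 0 < ε := by positivity
  have hε1 : ε < 1 / 2 := by
    rw [hε, div_lt_iff₀ (by positivity)]; linarith
  have hcos0 : 0 ≤ Real.cos (Real.pi * ε) := by
    apply Real.cos_nonneg_of_neg_pi_div_two_le_of_le <;> nlinarith [Real.pi_pos]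
  have hcos1 : Real.cos (Real.pi * ε) < 1 := by
    rw [← Real.cos_zero]
    apply Real.cos_lt_cos_of_nonneg_of_le_pi le_rfl <;> nlinarith [Real.pi_pos]
  have hL1 : (1 : ENNReal) ≤ ENNReal.ofReal (M / a) := by
    rw [ENNReal.one_le_ofReal, one_le_div ha]; linarith
  -- `q₁` makes the cosine power negligible even after multiplication by `L`; `q₂` ensures `1 / q ≤
  -- τ / 8`.
  obtain ⟨q₁, hq₁⟩ := exists_pow_lt_of_lt_one (show 0 < a ^ 2 / M ^ 2 by positivity) hcos1
  obtain ⟨q₂, hq₂⟩ := exists_nat_ge (8 / τ)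
  refine ⟨ε, ENNReal.ofReal (M / a), hL1, ENNReal.ofReal_ne_top, max (max q₁ q₂) 1, ?_⟩
  intro q hq T hT
  have hq1 : 1 ≤ q := (le_max_right _ _).trans hq
  have hq0 : (0 : ℝ) < q := by exact_mod_cast hq1
  have hqτ : (1 / q : ℝ) ≤ τ / 8 := by
    have h1 : (q₂ : ℝ) ≤ q := by
      exact_mod_cast (le_max_right _ _).trans ((le_max_left _ _).trans hq)
    have h2 : 8 / τ ≤ q := hq₂.trans h1
    rw [div_le_iff₀ hτ] at h2
    rw [div_le_div_iff₀ hq0 (by norm_num)]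
    linarith
  have hqs1 : (1 / q : ℝ) ≤ 1 := by
    rw [div_le_one hq0]; exact_mod_cast hq1
  have hk : Real.cos (Real.pi * ε) ^ q ≤ a ^ 2 / M ^ 2 :=
    (pow_le_pow_of_le_one hcos0 hcos1.le
      ((le_max_left _ _).trans ((le_max_left _ _).trans hq))).trans hq₁.le
  -- The crude value must not involve `ρ₀`, which was fixed before `L = M / a`. For `R j < ρ₀` one
  -- has `M ≤ 3 / R j`, so `L * (2 + 1 / R j) ≤ 9 / a * (R j ^ 2)⁻¹`, free of `ρ₀`.
  set c : J → ENNReal := fun j =>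
    ENNReal.ofReal (if R j < ρ₀ then 9 / a * (R j ^ 2)⁻¹ else 1 + 3 * a) with hc
  have hcpos : ∀ j, (0 : ℝ) < if R j < ρ₀ then 9 / a * (R j ^ 2)⁻¹ else 1 + 3 * a := fun j => by
    have := hR j
    split_ifs <;> positivity
  have hH1 : ∀ x : ℝ, ENNReal.ofReal |Real.cos (Real.pi * x)| ^ q ≤ 1 := fun x =>
    pow_le_one₀ bot_le (ENNReal.ofReal_le_one.2 (Real.abs_cos_le_one _))
  refine (cellSum_weight_pow_le P R c (fun j => (ENNReal.ofReal_pos.2 (hcpos j)).ne')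
    (fun j => ENNReal.ofReal_ne_top) hRρ hq1 (latticeWeight ε (ENNReal.ofReal (M / a)))
    (fun x => ENNReal.ofReal |Real.cos (Real.pi * x)|) f f hT hf ?_).trans ?_
  · intro j
    have hRj := hR j
    by_cases hj : R j < ρ₀
    · refine (cellSum_weight_comp_mul_le hL1 (fun x => ENNReal.ofReal |Real.cos (Real.pi * x)| ^ q)
        (fun x => f x ^ q) hH1 hRj T).trans ?_
      gcongr
      rw [hc]
      simp only [hj, if_true]
      rw [← ENNReal.ofReal_mul (by positivity)]
      apply ENNReal.ofReal_le_ofReal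
      have hRj1 : R j ≤ 1 := (hRρ j).trans hρ1
      have h1 : M ≤ 3 / R j := by
        have h2 : 1 / ρ₀ ≤ 1 / R j := one_div_le_one_div_of_le hRj hj.le
        have h3 : 1 ≤ 1 / R j := by rw [le_div_iff₀ hRj]; linarith
        have : 3 / R j = 3 * (1 / R j) := by ring
        rw [this]; linarith
      have h2 : 2 + 1 / R j ≤ 3 / R j := by
        have h3 : 1 ≤ 1 / R j := by rw [le_div_iff₀ hRj]; linarith
        have : 3 / R j = 3 * (1 / R j) := by ring
        rw [this]; linarith
      calc M / a * (2 + 1 / R j) ≤ (3 / R j) / a * (3 / R j) := by gcongr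
        _ = _ := by field_simp; norm_num
    · refine (cellSum_weight_comp_mul_le_of_far hε0.le hL1 ENNReal.ofReal_ne_top
        (fun x => ENNReal.ofReal |Real.cos (Real.pi * x)| ^ q) (fun x => f x ^ q) hH1
        (κ := ENNReal.ofReal (Real.cos (Real.pi * ε) ^ q)) (fun x hx => ?_) hRj T).trans ?_
      · rw [ENNReal.ofReal_pow hcos0]
        gcongr
        exact abs_cos_pi_mul_le hε0.le hx.le
      · gcongr
        rw [hc]
        simp only [hj, if_false]
        refine ofReal_far_coefficient_le ha hM0 (by positivity) hk hRj ?_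
        have h2 : 1 / R j ≤ 1 / ρ₀ := one_div_le_one_div_of_le hρ₀ (not_lt.1 hj)
        linarith
  · gcongr
    refine tsum_mul_rpow_pow_le P R c ha hK0 hP hPR' hR hq1 fun j => ?_
    have hRj := hR j
    have hRτ : 0 ≤ R j ^ (-τ) := Real.rpow_nonneg hRj.le _
    rw [hc, ENNReal.ofReal_rpow_of_pos (hcpos j)]
    apply ENNReal.ofReal_le_ofReal
    have hs0 : (0 : ℝ) < 1 / q := by positivity
    split_ifs with hj
    · have := hsmall (1 / q) hs0 hqτ (R j) hRj hj
      have : 0 ≤ 3 * a * (1 / q) := by positivity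
      linarith
    -- Bernoulli's inequality: `(1 + 3 * a) ^ (1 / q) ≤ 1 + 3 * a / q`.
    · have h1 := rpow_one_add_le_one_add_mul_self (s := 3 * a) (by linarith) hs0.le hqs1
      have h2 : 0 ≤ 1 / q * (a / (K + 1) * R j ^ (-τ)) := by positivity
      linarith

/-- The one-scale bound is iterated along `T = ρ⁻¹ ^ n`, with `a` so small that `exp (4 * a) ≤ ρ⁻¹ ^
γ`. Every large `q` is allowed, so that `q` can meet a further condition later. -/
theorem exists_cellSum_pow_le {J : Type*} (P : J → ENNReal) (R : J → ℝ) {ρ τ γ : ℝ}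
    (hρ : 0 < ρ) (hρ1 : ρ < 1) (hR : ∀ j, 0 < R j) (hRρ : ∀ j, R j ≤ ρ) (hP : ∑' j, P j ≤ 1)
    (hτ : 0 < τ) (hPR : ∑' j, P j * ENNReal.ofReal (R j ^ (-τ)) ≠ ⊤) (f : ℝ → ENNReal)
    (hf1 : ∀ x, f x ≤ 1)
    (hf : ∀ x, f x ≤ ENNReal.ofReal |Real.cos (Real.pi * x)| * ∑' j, P j * f (R j * x))
    (hγ : 0 < γ) :
    ∃ q₀ : ℕ, ∀ q : ℕ, q₀ ≤ q → ∃ C : ℝ, 0 ≤ C ∧ ∀ T : ℝ, 1 ≤ T →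
      cellSum (fun x => f x ^ q) T ≤ ENNReal.ofReal (C * T ^ γ) := by
  have hlog : 0 < Real.log ρ⁻¹ := Real.log_pos ((one_lt_inv₀ hρ).2 hρ1)
  set a : ℝ := min 1 (γ * Real.log ρ⁻¹ / 4) with ha
  have ha0 : 0 < a := lt_min one_pos (by positivity)
  have hE : Real.exp (4 * a) ≤ ρ⁻¹ ^ γ := by
    rw [Real.rpow_def_of_pos (by positivity)]
    apply Real.exp_le_exp.2
    have : a ≤ γ * Real.log ρ⁻¹ / 4 := min_le_right _ _
    linarith
  obtain ⟨ε, L, hL1, hL, q₀, hq₀⟩ := exists_cellSum_weight_pow_le P R hρ1.le hR hRρ hP hτ hPR f hf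
    ha0 (min_le_left _ _)
  refine ⟨q₀, fun q hq => ?_⟩
  set V : ℝ → ENNReal := cellSum fun x => latticeWeight ε L x * f x ^ q with hV
  have hV1 : V 1 ≠ ⊤ := by
    refine (cellSum_lt_top hL.lt_top (fun x => ?_) 1).ne
    calc latticeWeight ε L x * f x ^ q ≤ L * 1 := by
          gcongr
          · exact latticeWeight_le hL1 x
          · exact pow_le_one₀ bot_le (hf1 x)
      _ = L := mul_one L
  have hiter : ∀ n : ℕ, V (ρ⁻¹ ^ n) ≤ ENNReal.ofReal ((ρ⁻¹ ^ γ) ^ n) * V 1 := by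
    intro n
    induction n with
    | zero => simp
    | succ n ih =>
      refine (hq₀ q hq (ρ⁻¹ ^ (n + 1)) (by positivity)).trans ?_
      have e : ρ * ρ⁻¹ ^ (n + 1) = ρ⁻¹ ^ n := by
        rw [pow_succ, mul_comm, mul_assoc, inv_mul_cancel₀ hρ.ne', mul_one]
      rw [e, pow_succ, mul_comm _ (ρ⁻¹ ^ γ), ENNReal.ofReal_mul (by positivity), mul_assoc]
      gcongr
  refine ⟨ρ⁻¹ ^ γ * (V 1).toReal, by positivity, fun T hT => ?_⟩
  obtain ⟨n, hn1, hn2⟩ := exists_nat_pow_near hT ((one_lt_inv₀ hρ).2 hρ1)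
  calc cellSum (fun x => f x ^ q) T ≤ V (ρ⁻¹ ^ (n + 1)) := by
        refine cellSum_mono (fun x => ?_) hn2.le
        exact le_mul_of_one_le_left bot_le (one_le_latticeWeight hL1 x)
    _ ≤ ENNReal.ofReal ((ρ⁻¹ ^ γ) ^ (n + 1)) * V 1 := hiter (n + 1)
    _ = ENNReal.ofReal ((ρ⁻¹ ^ γ) ^ (n + 1) * (V 1).toReal) := by
        rw [ENNReal.ofReal_mul (by positivity), ENNReal.ofReal_toReal hV1]
    _ ≤ _ := by
        apply ENNReal.ofReal_le_ofReal
        have h : (ρ⁻¹ ^ γ) ^ n ≤ T ^ γ := by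
          rw [← Real.rpow_natCast, ← Real.rpow_mul (by positivity), mul_comm,
            Real.rpow_mul (by positivity), Real.rpow_natCast]
          gcongr
        calc (ρ⁻¹ ^ γ) ^ (n + 1) * (V 1).toReal
            = ρ⁻¹ ^ γ * (V 1).toReal * (ρ⁻¹ ^ γ) ^ n := by ring
          _ ≤ _ := by gcongr

/-- A bound for `f` passes to an average of its dilates: the loss at ratio `R j` is at most `3 / R
j`, and after Hölder only its `1 / q`-th power must be summable against `P`. -/
theorem exists_cellSum_pow_le_of_le_tsum {J : Type*} (P : J → ENNReal) (R : J → ℝ) {τ : ℝ}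
    (hR : ∀ j, 0 < R j) (hR1 : ∀ j, R j ≤ 1) {q : ℕ} (hq : 1 ≤ q) (hqτ : (1 / q : ℝ) ≤ τ)
    (hPR : ∑' j, P j * ENNReal.ofReal (R j ^ (-τ)) ≠ ⊤) (f g : ℝ → ENNReal)
    (hg : ∀ x, g x ≤ ∑' j, P j * f (R j * x)) :
    ∃ C : ℝ, 0 ≤ C ∧ ∀ T : ℝ, 0 ≤ T →
      cellSum (fun x => g x ^ q) T ≤ ENNReal.ofReal C * cellSum (fun x => f x ^ q) T := by
  set c : J → ENNReal := fun j => ENNReal.ofReal (2 + 1 / R j) with hc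
  have hcpos : ∀ j, 0 < 2 + 1 / R j := fun j => by have := hR j; positivity
  set Z := ∑' j, P j * c j ^ (1 / q : ℝ) with hZ
  have hq0 : (0 : ℝ) < q := by exact_mod_cast hq
  have hqs1 : (1 / q : ℝ) ≤ 1 := by
    rw [div_le_one hq0]; exact_mod_cast hq
  have hZt : Z ≠ ⊤ := by
    refine ne_top_of_le_ne_top (ENNReal.mul_ne_top (ENNReal.ofReal_ne_top (r := 3)) hPR) ?_
    rw [← ENNReal.tsum_mul_left]
    refine ENNReal.tsum_le_tsum fun j => ?_
    have hRj := hR j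
    rw [mul_left_comm, ← ENNReal.ofReal_mul (by norm_num), hc,
      ENNReal.ofReal_rpow_of_pos (hcpos j)]
    gcongr
    have h3 : 1 ≤ 1 / R j := by rw [le_div_iff₀ hRj]; linarith [hR1 j]
    calc (2 + 1 / R j) ^ (1 / q : ℝ) ≤ (3 * (1 / R j)) ^ (1 / q : ℝ) := by
          gcongr; linarith
      _ = 3 ^ (1 / q : ℝ) * (1 / R j) ^ (1 / q : ℝ) := Real.mul_rpow (by norm_num) (by positivity)
      _ ≤ 3 ^ (1 : ℝ) * (1 / R j) ^ τ := by gcongr; norm_num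
      _ = _ := by rw [Real.rpow_one, one_div, Real.inv_rpow hRj.le, Real.rpow_neg hRj.le]
  refine ⟨(Z ^ q).toReal, by positivity, fun T hT => ?_⟩
  rw [ENNReal.ofReal_toReal (ENNReal.pow_ne_top hZt)]
  have := cellSum_weight_pow_le P R c (fun j => (ENNReal.ofReal_pos.2 (hcpos j)).ne')
    (fun j => ENNReal.ofReal_ne_top) hR1 hq (fun _ => 1) (fun _ => 1) f g hT
    (fun x => by simpa using hg x) (fun j => by
      simpa [hc] using cellSum_comp_mul_le' (fun x => f x ^ q) (hR j) T)
  simpa [hZ] using this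

/-! ### Sums over words and the renewal inequality. -/

theorem ENNReal.tsum_list {B : Type*} (F : List B → ENNReal) :
    ∑' l, F l = F [] + ∑' b, ∑' l, F (b :: l) := by
  let e : Unit ⊕ (B × List B) ≃ List B :=
    { toFun := Sum.elim (fun _ => []) fun x => x.1 :: x.2
      invFun := fun l => match l with
        | [] => Sum.inl ()
        | b :: l => Sum.inr (b, l)
      left_inv := by rintro (_ | ⟨b, l⟩) <;> rfl
      right_inv := by rintro (_ | ⟨b, l⟩) <;> rfl }
  rw [← e.tsum_eq, Summable.tsum_sum ENNReal.summable ENNReal.summable, ENNReal.tsum_prod']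
  simp [e]

/-- The geometric series over the words in an alphabet. -/
theorem ENNReal.tsum_list_prod {B : Type*} (w : B → ENNReal) :
    ∑' l : List B, (l.map w).prod = (1 - ∑' b, w b)⁻¹ := by
  have h : ∀ n : ℕ, ∑' l : List B, (if l.length = n then (l.map w).prod else 0)
      = (∑' b, w b) ^ n := by
    intro n
    induction n with
    | zero => rw [ENNReal.tsum_list]; simp
    | succ n ih =>
      rw [ENNReal.tsum_list, pow_succ', ← ih, ← ENNReal.tsum_mul_right]
      simp [← ENNReal.tsum_mul_left]
  rw [← ENNReal.tsum_geometric]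
  simp_rw [← h]
  rw [ENNReal.tsum_comm]
  refine tsum_congr fun l => ?_
  rw [tsum_eq_single l.length fun n hn => if_neg (Ne.symm hn)]
  simp

/-- A solution of a renewal inequality is bounded by the corresponding sum over words. -/
theorem le_tsum_list_of_renewal {B : Type*} (p : B → ENNReal) (r : B → ℝ) (hp : ∑' b, p b < 1)
    (f g : ℝ → ENNReal) (hg1 : ∀ x, g x ≤ 1)
    (hg : ∀ x, g x ≤ f x + ∑' b, p b * g (r b * x)) (x : ℝ) :
    g x ≤ ∑' l : List B, (l.map p).prod * f ((l.map r).prod * x) := by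
  set S : ℝ → ENNReal := fun x => ∑' l : List B, (l.map p).prod * f ((l.map r).prod * x) with hS
  have hrec : ∀ x, S x = f x + ∑' b, p b * S (r b * x) := fun x => by
    simp only [hS]
    rw [ENNReal.tsum_list]
    congr 1
    · simp
    · refine tsum_congr fun b => ?_
      rw [← ENNReal.tsum_mul_left]
      refine tsum_congr fun l => ?_
      rw [List.map_cons, List.prod_cons, List.map_cons, List.prod_cons, mul_assoc]
      congr 3
      ring
  -- `S` solves the renewal equation exactly, so each use of the inequality shrinks the excess of
  -- `g` over `S` by the factor `∑ p b < 1`.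
  have hn : ∀ n : ℕ, ∀ x, g x ≤ S x + (∑' b, p b) ^ n := by
    intro n
    induction n with
    | zero => intro x; rw [pow_zero]; exact le_add_left (hg1 x)
    | succ n ih =>
      intro x
      calc g x ≤ f x + ∑' b, p b * (S (r b * x) + (∑' b, p b) ^ n) := by
            refine (hg x).trans ?_
            gcongr with b
            exact ih _
        _ = S x + (∑' b, p b) ^ (n + 1) := by
            simp_rw [mul_add]
            rw [ENNReal.tsum_add, ENNReal.tsum_mul_right, ← add_assoc, ← hrec, pow_succ']
  have hlim : Filter.Tendsto (fun n : ℕ => S x + (∑' b, p b) ^ n) Filter.atTop (nhds (S x + 0)) :=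
    tendsto_const_nhds.add (ENNReal.tendsto_pow_atTop_nhds_zero_of_lt_one hp)
  rw [add_zero] at hlim
  exact ge_of_tendsto' hlim fun n => hn n x

/-- By Bernoulli's inequality `r ^ (-s * τ) ≤ 1 + s * r ^ (-τ)`, so small `s` keeps the sum below
one. This makes the geometric series over words converge with the moment included. -/
theorem exists_tsum_mul_rpow_lt_one {B : Type*} (p : B → ENNReal) (r : B → ℝ) {τ : ℝ} (hτ : 0 < τ)
    (hr : ∀ b, 0 < r b) (hp : ∑' b, p b < 1)
    (hpr : ∑' b, p b * ENNReal.ofReal (r b ^ (-τ)) ≠ ⊤) :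
    ∃ σ : ℝ, 0 < σ ∧ ∑' b, p b * ENNReal.ofReal (r b ^ (-σ)) < 1 := by
  set m : ℝ := (∑' b, p b * ENNReal.ofReal (r b ^ (-τ))).toReal with hm
  set θ : ℝ := (∑' b, p b).toReal with hθ
  have hm0 : 0 ≤ m := ENNReal.toReal_nonneg
  have hθ0 : 0 ≤ θ := ENNReal.toReal_nonneg
  have hpt : ∑' b, p b ≠ ⊤ := hp.ne_top
  have hθ1 : θ < 1 := by
    rw [hθ, ← ENNReal.toReal_one]
    exact (ENNReal.toReal_lt_toReal hpt ENNReal.one_ne_top).2 hp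
  set s : ℝ := min 1 ((1 - θ) / (2 * (m + 1))) with hs
  have h1θ : 0 < 1 - θ := by linarith
  have hs0 : 0 < s := lt_min one_pos (by positivity)
  have hs1 : s ≤ 1 := min_le_left _ _
  have hsm : s * m ≤ (1 - θ) / 2 := by
    calc s * m ≤ (1 - θ) / (2 * (m + 1)) * (m + 1) := by
          gcongr
          · exact min_le_right _ _
          · linarith
      _ = (1 - θ) / 2 := by field_simp
  refine ⟨s * τ, by positivity, ?_⟩
  calc ∑' b, p b * ENNReal.ofReal (r b ^ (-(s * τ)))
      ≤ ∑' b, (p b + ENNReal.ofReal s * (p b * ENNReal.ofReal (r b ^ (-τ)))) := by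
        refine ENNReal.tsum_le_tsum fun b => ?_
        have hb : 0 ≤ r b ^ (-τ) := Real.rpow_nonneg (hr b).le _
        rw [mul_left_comm, ← ENNReal.ofReal_mul hs0.le]
        nth_rw 2 [← mul_one (p b)]
        rw [← mul_add, ← ENNReal.ofReal_one, ← ENNReal.ofReal_add zero_le_one (by positivity)]
        gcongr
        have h := rpow_one_add_le_one_add_mul_self (s := r b ^ (-τ) - 1) (by linarith) hs0.le hs1
        rw [add_sub_cancel, ← Real.rpow_mul (hr b).le] at h
        have e : -τ * s = -(s * τ) := by ring
        rw [e] at h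
        linarith
    _ = ENNReal.ofReal θ + ENNReal.ofReal s * ENNReal.ofReal m := by
        rw [ENNReal.tsum_add, ENNReal.tsum_mul_left, hθ, hm, ENNReal.ofReal_toReal hpr,
          ENNReal.ofReal_toReal hpt]
    _ = ENNReal.ofReal (θ + s * m) := by
        rw [← ENNReal.ofReal_mul hs0.le, ← ENNReal.ofReal_add hθ0 (by positivity)]
    _ < 1 := by
        rw [ENNReal.ofReal_lt_one]; linarith

theorem List.prod_map_mem_Ioc {B : Type*} (r : B → ℝ) (hr : ∀ b, 0 < r b) (hr1 : ∀ b, r b ≤ 1)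
    (l : List B) : 0 < (l.map r).prod ∧ (l.map r).prod ≤ 1 := by
  induction l with
  | nil => simp
  | cons b l ih =>
    rw [List.map_cons, List.prod_cons]
    exact ⟨mul_pos (hr b) ih.1, mul_le_one₀ (hr1 b) ih.1.le ih.2⟩

theorem List.prod_map_mul_rpow {B : Type*} (p : B → ENNReal) (r : B → ℝ) (hr : ∀ b, 0 < r b)
    (hr1 : ∀ b, r b ≤ 1) (σ : ℝ) (l : List B) :
    (l.map p).prod * ENNReal.ofReal ((l.map r).prod ^ (-σ))
      = (l.map fun b => p b * ENNReal.ofReal (r b ^ (-σ))).prod := by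
  induction l with
  | nil => simp
  | cons b l ih =>
    have hl := (List.prod_map_mem_Ioc r hr hr1 l).1
    simp only [List.map_cons, List.prod_cons]
    rw [Real.mul_rpow (hr b).le hl.le, ENNReal.ofReal_mul (Real.rpow_nonneg (hr b).le _), ← ih]
    ring

/-- The `L^q`-flattening of a function that satisfies a renewal inequality one of whose terms has a
cosine as a factor. -/
theorem exists_cellSum_pow_le_of_renewal {B : Type*} (p : B → ENNReal) (r : B → ℝ) (w : ENNReal)
    {r₀ ρ τ : ℝ} (hρ : 0 < ρ) (hρ1 : ρ < 1) (hr : ∀ b, 0 < r b) (hrρ : ∀ b, r b ≤ ρ)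
    (hr₀ : 0 < r₀) (hr₀ρ : r₀ ≤ ρ) (hw : w ≠ 0) (hp : w + ∑' b, p b ≤ 1) (hτ : 0 < τ)
    (hpr : ∑' b, p b * ENNReal.ofReal (r b ^ (-τ)) ≠ ⊤) (g : ℝ → ENNReal) (hg1 : ∀ x, g x ≤ 1)
    (hg : ∀ x, g x ≤ w * ENNReal.ofReal |Real.cos (Real.pi * x)| * g (r₀ * x)
      + ∑' b, p b * g (r b * x)) {γ : ℝ} (hγ : 0 < γ) :
    ∃ q : ℕ, 1 ≤ q ∧ ∃ C : ℝ, 0 ≤ C ∧ ∀ T : ℝ, 1 ≤ T →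
      cellSum (fun x => g x ^ q) T ≤ ENNReal.ofReal (C * T ^ γ) := by
  have hr1 : ∀ b, r b ≤ 1 := fun b => (hrρ b).trans hρ1.le
  have hwt : w ≠ ⊤ := (lt_of_le_of_lt (le_self_add.trans hp) ENNReal.one_lt_top).ne
  have hθt : ∑' b, p b ≠ ⊤ := (lt_of_le_of_lt (le_add_self.trans hp) ENNReal.one_lt_top).ne
  have hθ1 : ∑' b, p b < 1 := by
    refine lt_of_lt_of_le ?_ hp
    rw [add_comm]
    exact ENNReal.lt_add_right hθt hw
  have hw1 : w ≤ 1 - ∑' b, p b := ENNReal.le_sub_of_add_le_right hθt hp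
  obtain ⟨σ, hσ, hσ1⟩ := exists_tsum_mul_rpow_lt_one p r hτ hr hθ1 hpr
  set f : ℝ → ENNReal := fun x => w * ENNReal.ofReal |Real.cos (Real.pi * x)| * g (r₀ * x) with hf
  set P : List B → ENNReal := fun l => (l.map p).prod with hP
  set R : List B → ℝ := fun l => (l.map r).prod with hR
  have hR0 : ∀ l, 0 < R l := fun l => (List.prod_map_mem_Ioc r hr hr1 l).1
  have hR1 : ∀ l, R l ≤ 1 := fun l => (List.prod_map_mem_Ioc r hr hr1 l).2
  have hgS : ∀ x, g x ≤ ∑' l, P l * f (R l * x) := le_tsum_list_of_renewal p r hθ1 f g hg1 hg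
  have hPR : ∑' l, P l * ENNReal.ofReal (R l ^ (-σ)) ≠ ⊤ := by
    simp_rw [hP, hR, List.prod_map_mul_rpow p r hr hr1 σ]
    rw [ENNReal.tsum_list_prod]
    exact ENNReal.inv_ne_top.2 (tsub_pos_of_lt hσ1).ne'
  -- Inserting `hgS` into the factor `g (r₀ * x)` of `f` closes the inequality on `f`, with the
  -- cosine in front of the whole sum. The new weights have total `w * (1 - ∑ p b)⁻¹ ≤ 1`.
  obtain ⟨q₀, hq₀⟩ := exists_cellSum_pow_le (fun l => w * P l) (fun l => R l * r₀) hρ hρ1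
    (fun l => mul_pos (hR0 l) hr₀)
    (fun l => (mul_le_of_le_one_left hr₀.le (hR1 l)).trans hr₀ρ) (by
      rw [ENNReal.tsum_mul_left, hP, ENNReal.tsum_list_prod]
      calc _ ≤ (1 - ∑' b, p b) * (1 - ∑' b, p b)⁻¹ := by gcongr
        _ ≤ 1 := ENNReal.mul_inv_le_one _) hσ (by
      have : ∀ l, w * P l * ENNReal.ofReal ((R l * r₀) ^ (-σ))
          = w * ENNReal.ofReal (r₀ ^ (-σ)) * (P l * ENNReal.ofReal (R l ^ (-σ))) := fun l => by
        rw [Real.mul_rpow (hR0 l).le hr₀.le, ENNReal.ofReal_mul (Real.rpow_nonneg (hR0 l).le _)]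
        ring
      simp_rw [this]
      rw [ENNReal.tsum_mul_left]
      exact ENNReal.mul_ne_top (ENNReal.mul_ne_top hwt ENNReal.ofReal_ne_top) hPR) f (fun x => by
      calc f x ≤ 1 * 1 * 1 := by
            simp only [hf]
            gcongr
            · exact le_self_add.trans hp
            · exact ENNReal.ofReal_le_one.2 (Real.abs_cos_le_one _)
            · exact hg1 _
        _ = 1 := by norm_num) (fun x => by
      calc f x ≤ w * ENNReal.ofReal |Real.cos (Real.pi * x)| *
            ∑' l, P l * f (R l * (r₀ * x)) := by
            simp only [hf]; gcongr; exact hgS _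
        _ = _ := by
            rw [mul_comm w, mul_assoc, ← ENNReal.tsum_mul_left]
            simp_rw [mul_assoc]) hγ
  obtain ⟨q₁, hq₁⟩ := exists_nat_ge (1 / σ)
  set q : ℕ := max (max q₀ q₁) 1 with hq
  have hq1 : 1 ≤ q := le_max_right _ _
  have hqσ : (1 / q : ℝ) ≤ σ := by
    have h1 : (q₁ : ℝ) ≤ q := by exact_mod_cast (le_max_right _ _).trans (le_max_left _ _)
    have h2 : 1 / σ ≤ q := hq₁.trans h1
    have hq0 : (0 : ℝ) < q := by exact_mod_cast hq1
    rw [div_le_iff₀ hσ] at h2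
    rw [div_le_iff₀ hq0]
    linarith
  obtain ⟨C₁, hC₁, h₁⟩ := hq₀ q ((le_max_left _ _).trans (le_max_left _ _))
  obtain ⟨C₂, hC₂, h₂⟩ := exists_cellSum_pow_le_of_le_tsum P R hR0 hR1 hq1 hqσ hPR f g hgS
  refine ⟨q, hq1, C₂ * C₁, by positivity, fun T hT => (h₂ T (by linarith)).trans ?_⟩
  rw [mul_assoc, ENNReal.ofReal_mul hC₂]
  gcongr
  exact h₁ T hT

/-! ### The Fourier transform of a stationary measure. -/

theorem norm_exp_fourier (ξ x : ℝ) :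
    ‖Complex.exp (-2 * (Real.pi : ℂ) * Complex.I * (ξ : ℂ) * (x : ℂ))‖ = 1 := by
  have : -2 * (Real.pi : ℂ) * Complex.I * (ξ : ℂ) * (x : ℂ)
      = ((-2 * Real.pi * ξ * x : ℝ) : ℂ) * Complex.I := by push_cast; ring
  rw [this, Complex.norm_exp_ofReal_mul_I]

theorem norm_measureFourier_le_one (μ : Measure ℝ) [IsProbabilityMeasure μ] (ξ : ℝ) :
    ‖measureFourier μ ξ‖ ≤ 1 := by
  refine (norm_integral_le_integral_norm _).trans ?_
  simp only [norm_exp_fourier]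
  simp

theorem norm_measureFourier_neg (μ : Measure ℝ) (ξ : ℝ) :
    ‖measureFourier μ (-ξ)‖ = ‖measureFourier μ ξ‖ := by
  rw [← RCLike.norm_conj (measureFourier μ ξ)]
  unfold measureFourier
  rw [← integral_conj]
  congr 2
  funext x
  rw [← Complex.exp_conj]
  simp [Complex.conj_ofNat]

/-- Conjugation symmetry makes the signs of the ratios irrelevant, so the renewal argument can work
with positive ratios. -/
theorem norm_measureFourier_abs_mul (μ : Measure ℝ) (r ξ : ℝ) :
    ‖measureFourier μ (|r| * ξ)‖ = ‖measureFourier μ (r * ξ)‖ := by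
  rcases abs_choice r with h | h <;> rw [h]
  rw [neg_mul, norm_measureFourier_neg]

theorem integrable_exp_fourier (μ : Measure ℝ) [IsFiniteMeasure μ] (ξ : ℝ) :
    Integrable (fun x : ℝ => Complex.exp (-2 * (Real.pi : ℂ) * Complex.I * (ξ : ℂ) * (x : ℂ))) μ :=
  Integrable.of_bound (by fun_prop) 1 (Filter.Eventually.of_forall fun x =>
    (norm_exp_fourier ξ x).le)

theorem hasSum_measureFourier {ι : Type*} {φ : ι → ℝ → ℝ} {r t p : ι → ℝ}
    (hφ : ∀ a x, φ a x = r a * x + t a) (hp : ∀ a, 0 < p a) {μ : Measure ℝ}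
    (hμ : IsStationaryMeasure φ p μ) (ξ : ℝ) :
    HasSum (fun a => (p a : ℂ) * Complex.exp (-2 * (Real.pi : ℂ) * Complex.I * (ξ : ℂ) * (t a : ℂ))
      * measureFourier μ (r a * ξ)) (measureFourier μ ξ) := by
  have := hμ.1
  have hint := integrable_exp_fourier μ ξ
  rw [hμ.2] at hint
  have h := hasSum_integral_measure hint
  rw [← hμ.2] at h
  refine h.congr_fun fun a => ?_
  have hmeas : Measurable (φ a) := by
    have : φ a = fun x => r a * x + t a := funext (hφ a)
    rw [this]; fun_prop
  rw [integral_smul_measure, integral_map hmeas.aemeasurable (by fun_prop),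
    ENNReal.toReal_ofReal (hp a).le, Complex.real_smul, mul_assoc]
  congr 1
  unfold measureFourier
  rw [← integral_const_mul]
  congr 1
  funext x
  rw [← Complex.exp_add, hφ]
  congr 1
  push_cast; ring

/-- Factoring out the phase of the midpoint `(s + t) / 2` leaves twice a cosine. -/
theorem norm_exp_add_exp_fourier (ξ s t : ℝ) :
    ‖Complex.exp (-2 * (Real.pi : ℂ) * Complex.I * (ξ : ℂ) * (s : ℂ))
      + Complex.exp (-2 * (Real.pi : ℂ) * Complex.I * (ξ : ℂ) * (t : ℂ))‖
      = 2 * |Real.cos (Real.pi * ((s - t) * ξ))| := by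
  have h : Complex.exp (-2 * (Real.pi : ℂ) * Complex.I * (ξ : ℂ) * (s : ℂ))
      + Complex.exp (-2 * (Real.pi : ℂ) * Complex.I * (ξ : ℂ) * (t : ℂ))
      = Complex.exp (-2 * (Real.pi : ℂ) * Complex.I * (ξ : ℂ) * (((s + t) / 2 : ℝ) : ℂ)) *
        (2 * (Real.cos (Real.pi * ((s - t) * ξ)) : ℂ)) := by
    rw [Complex.ofReal_cos, Complex.two_cos, mul_add, ← Complex.exp_add, ← Complex.exp_add,
      add_comm]
    congr 2 <;> (push_cast; ring)
  rw [h, norm_mul, norm_exp_fourier, one_mul, norm_mul, Complex.norm_real]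
  simp

section Pairs

variable {ι : Type*} {φ : ι → ℝ → ℝ} {r t p : ι → ℝ} {μ : Measure ℝ}

theorem hasSum_measureFourier_pairs (hφ : ∀ a x, φ a x = r a * x + t a) (hp : ∀ a, 0 < p a)
    (hps : Summable p) (hμ : IsStationaryMeasure φ p μ) (ξ : ℝ) :
    HasSum (fun x : ι × ι => ((p x.1 * p x.2 : ℝ) : ℂ) *
      Complex.exp (-2 * (Real.pi : ℂ) * Complex.I * (ξ : ℂ) * ((t x.1 + r x.1 * t x.2 : ℝ) : ℂ))
      * measureFourier μ (r x.1 * r x.2 * ξ)) (measureFourier μ ξ) := by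
  have := hμ.1
  have hsum : Summable (fun x : ι × ι => ((p x.1 * p x.2 : ℝ) : ℂ) *
      Complex.exp (-2 * (Real.pi : ℂ) * Complex.I * (ξ : ℂ) * ((t x.1 + r x.1 * t x.2 : ℝ) : ℂ))
      * measureFourier μ (r x.1 * r x.2 * ξ)) := by
    refine Summable.of_norm_bounded
      (hps.mul_of_nonneg hps (fun a => (hp a).le) (fun a => (hp a).le)) fun x => ?_
    have hpos : 0 < p x.1 * p x.2 := mul_pos (hp _) (hp _)
    rw [norm_mul, norm_mul, norm_exp_fourier, mul_one, Complex.norm_real, Real.norm_eq_abs,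
      abs_of_pos hpos]
    exact mul_le_of_le_one_right hpos.le (norm_measureFourier_le_one μ _)
  have h1 := hsum.hasSum.prod_fiberwise fun a =>
    ((hasSum_measureFourier hφ hp hμ (r a * ξ)).mul_left
      ((p a : ℂ) * Complex.exp (-2 * (Real.pi : ℂ) * Complex.I * (ξ : ℂ) * (t a : ℂ)))).congr_fun
      fun b => by
        have e : Complex.exp
            (-2 * (Real.pi : ℂ) * Complex.I * (ξ : ℂ) * ((t a + r a * t b : ℝ) : ℂ))
            = Complex.exp (-2 * (Real.pi : ℂ) * Complex.I * (ξ : ℂ) * (t a : ℂ)) *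
              Complex.exp (-2 * (Real.pi : ℂ) * Complex.I * ((r a * ξ : ℝ) : ℂ) * (t b : ℂ)) := by
          rw [← Complex.exp_add]; congr 1; push_cast; ring
        dsimp only
        rw [e, mul_right_comm (r a), mul_comm _ (r b)]
        push_cast
        ring
  rw [← h1.unique (hasSum_measureFourier hφ hp hμ ξ)]
  exact hsum.hasSum

/-- The renewal inequality for the Fourier transform: the words `a b` and `b a` have the same
ratio, and their contributions interfere. -/
theorem norm_measureFourier_le_pairs (hφ : ∀ a x, φ a x = r a * x + t a) (hp : ∀ a, 0 < p a)
    (hps : Summable p) (hμ : IsStationaryMeasure φ p μ) {a b : ι} (hab : a ≠ b) (ξ : ℝ) :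
    ENNReal.ofReal ‖measureFourier μ ξ‖
      ≤ ENNReal.ofReal (2 * (p a * p b)) * ENNReal.ofReal
          |Real.cos (Real.pi * ((t a + r a * t b - (t b + r b * t a)) * ξ))| *
          ENNReal.ofReal ‖measureFourier μ (|r a * r b| * ξ)‖
        + ∑' x : ↥({(a, b), (b, a)} : Set (ι × ι))ᶜ, ENNReal.ofReal (p x.1.1 * p x.1.2) *
          ENNReal.ofReal ‖measureFourier μ (|r x.1.1 * r x.1.2| * ξ)‖ := by
  classical
  have hne : (a, b) ≠ (b, a) := fun h => hab (congrArg Prod.fst h)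
  have h := hasSum_measureFourier_pairs hφ hp hps hμ ξ
  set F : ι × ι → ℂ := fun x => ((p x.1 * p x.2 : ℝ) : ℂ) *
      Complex.exp (-2 * (Real.pi : ℂ) * Complex.I * (ξ : ℂ) * ((t x.1 + r x.1 * t x.2 : ℝ) : ℂ))
      * measureFourier μ (r x.1 * r x.2 * ξ) with hF
  have hnorm : ∀ x, ENNReal.ofReal ‖F x‖ = ENNReal.ofReal (p x.1 * p x.2) *
      ENNReal.ofReal ‖measureFourier μ (|r x.1 * r x.2| * ξ)‖ := fun x => by
    have hpos : 0 < p x.1 * p x.2 := mul_pos (hp _) (hp _)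
    rw [norm_measureFourier_abs_mul, ← ENNReal.ofReal_mul hpos.le]
    simp only [hF]
    rw [norm_mul, norm_mul, norm_exp_fourier, mul_one, Complex.norm_real, Real.norm_eq_abs,
      abs_of_pos hpos]
  have hsplit := h.summable.sum_add_tsum_compl (s := {(a, b), (b, a)})
  rw [h.tsum_eq, Finset.sum_pair hne] at hsplit
  have hpair : ‖F (a, b) + F (b, a)‖ = 2 * (p a * p b) *
      |Real.cos (Real.pi * ((t a + r a * t b - (t b + r b * t a)) * ξ))| *
      ‖measureFourier μ (|r a * r b| * ξ)‖ := by
    have hpos : 0 < p a * p b := mul_pos (hp _) (hp _)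
    have e : F (a, b) + F (b, a) = ((p a * p b : ℝ) : ℂ) *
        (Complex.exp
            (-2 * (Real.pi : ℂ) * Complex.I * (ξ : ℂ) * ((t a + r a * t b : ℝ) : ℂ))
          + Complex.exp
            (-2 * (Real.pi : ℂ) * Complex.I * (ξ : ℂ) * ((t b + r b * t a : ℝ) : ℂ)))
        * measureFourier μ (r a * r b * ξ) := by
      simp only [hF]
      rw [mul_comm (p b) (p a), mul_comm (r b) (r a)]
      ring
    rw [e, norm_mul, norm_mul, norm_exp_add_exp_fourier, norm_measureFourier_abs_mul,
      Complex.norm_real, Real.norm_eq_abs, abs_of_pos hpos]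
    ring
  have hpos : 0 < p a * p b := mul_pos (hp _) (hp _)
  rw [← ENNReal.ofReal_mul (by positivity), ← ENNReal.ofReal_mul (by positivity), ← hpair]
  simp_rw [← hnorm]
  have hn : Summable fun x : ↥({(a, b), (b, a)} : Set (ι × ι))ᶜ => ‖F x‖ :=
    h.summable.norm.comp_injective Subtype.val_injective
  rw [← ENNReal.ofReal_tsum_of_nonneg (fun x => norm_nonneg _) hn,
    ← ENNReal.ofReal_add (norm_nonneg _) (tsum_nonneg fun x => norm_nonneg _)]
  apply ENNReal.ofReal_le_ofReal
  rw [← hsplit]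
  refine (norm_add_le _ _).trans ?_
  gcongr
  have hcoe : ((({(a, b), (b, a)} : Finset (ι × ι)) : Set (ι × ι)))
      = ({(a, b), (b, a)} : Set (ι × ι)) := by simp
  rw [hcoe]
  exact norm_tsum_le_tsum_norm hn

end Pairs

/-- The maps of a non-trivial system contain two that do not commute. -/
theorem IsNontrivialIFS.exists_not_commute {ι : Type*} {φ : ι → ℝ → ℝ} {r t : ι → ℝ}
    (hnt : IsNontrivialIFS φ) (hφ : ∀ a x, φ a x = r a * x + t a) (hr : ∀ a, |r a| < 1) :
    ∃ a b, a ≠ b ∧ t a + r a * t b - (t b + r b * t a) ≠ 0 := by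
  by_contra! hcon
  have hne : ∀ a, 0 < 1 - r a := fun a => by linarith [(abs_lt.1 (hr a)).2]
  apply hnt
  rcases isEmpty_or_nonempty ι with h | ⟨⟨a⟩⟩
  · exact ⟨0, fun a => (h.false a).elim⟩
  -- This is the fixed point of `φ a`; a vanishing commutator with `φ b` says that `φ b` fixes it
  -- too.
  refine ⟨t a / (1 - r a), fun b => ?_⟩
  have hab : t a * (1 - r b) = t b * (1 - r a) := by
    by_cases h : a = b
    · rw [h]
    · have := hcon a b h
      linarith
  rw [hφ]
  have := (hne a).ne'
  field_simp
  linarith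

/-! ### From cell sums to coverings, and the conclusion. -/

/-- A set of reals that has few nonempty intersections with the cells of the lattice `d⁻¹ ℤ` is
covered by few unit intervals. -/
theorem coveredByUnitIntervals_of_round {S : Set ℝ} {d B : ℝ} (hd : d ≠ 0) (K : Finset ℤ)
    (hK : ∀ ξ ∈ S, round (d * ξ) ∈ K) (hB : (K.card : ℝ) * (⌊1 / |d|⌋₊ + 1) ≤ B) :
    CoveredByUnitIntervals S B := by
  classical
  set N : ℕ := ⌊1 / |d|⌋₊ + 1 with hN
  have hd' : 0 < |d| := abs_pos.2 hd
  refine ⟨(K ×ˢ Finset.range N).image fun x => (x.1 : ℝ) / d - 1 / (2 * |d|) + x.2, ?_, ?_⟩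
  · refine le_trans ?_ hB
    have h := Finset.card_image_le (s := K ×ˢ Finset.range N)
      (f := fun x => (x.1 : ℝ) / d - 1 / (2 * |d|) + x.2)
    rw [Finset.card_product, Finset.card_range] at h
    calc _ ≤ ((K.card * N : ℕ) : ℝ) := by exact_mod_cast h
      _ = _ := by rw [hN]; push_cast; ring
  · intro ξ hξ
    set k : ℤ := round (d * ξ) with hk
    set c : ℝ := (k : ℝ) / d - 1 / (2 * |d|) with hc
    have h1 : |ξ - k / d| ≤ 1 / (2 * |d|) := by
      have e : ξ - k / d = (d * ξ - k) / d := by field_simp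
      rw [e, abs_div, div_le_div_iff₀ hd' (by positivity)]
      nlinarith [abs_sub_round (d * ξ)]
    have h2 := abs_le.1 h1
    have h3 : 1 / |d| = 2 * (1 / (2 * |d|)) := by field_simp
    have h4 : 0 ≤ ξ - c := by rw [hc]; linarith [h2.1]
    have h5 : ξ - c ≤ 1 / |d| := by rw [hc, h3]; linarith [h2.2]
    rw [Set.mem_iUnion₂]
    refine ⟨c + ⌊ξ - c⌋₊, Finset.mem_image.2 ⟨(k, ⌊ξ - c⌋₊), ?_, rfl⟩, ?_, ?_⟩
    · rw [Finset.mem_product, Finset.mem_range]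
      exact ⟨hK ξ hξ, Nat.lt_succ_of_le (Nat.floor_le_floor h5)⟩
    · linarith [Nat.floor_le h4]
    · linarith [Nat.lt_floor_add_one (ξ - c)]

/-- Markov's inequality for `cellSum`. -/
theorem exists_finset_round_mem {F : ℝ → ENNReal} {S B y : ℝ} (hy : 0 < y) (hB : 0 ≤ B)
    (hF : cellSum F S ≤ ENNReal.ofReal B) :
    ∃ K : Finset ℤ, (K.card : ℝ) ≤ B / y ∧
      ∀ x, |x| ≤ S → ENNReal.ofReal y ≤ F x → round x ∈ K := by
  classical
  set A : Set ℤ := {k | ∃ x, |x| ≤ S ∧ ENNReal.ofReal y ≤ F x ∧ round x = k} with hA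
  have hcard : ∀ K : Finset ℤ, (↑K ⊆ A) → (K.card : ℝ) ≤ B / y := by
    intro K hKA
    rw [le_div_iff₀ hy]
    have h : ENNReal.ofReal (K.card * y) ≤ ENNReal.ofReal B := by
      rw [ENNReal.ofReal_mul (by positivity), ENNReal.ofReal_natCast, ← nsmul_eq_mul]
      refine le_trans ?_ ((ENNReal.sum_le_tsum K).trans hF)
      refine Finset.card_nsmul_le_sum K _ _ fun k hk => ?_
      obtain ⟨x, hx, hyx, hxk⟩ := hKA hk
      exact hyx.trans (le_iSup₂_of_le x ⟨hxk, hx⟩ le_rfl)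
    exact (ENNReal.ofReal_le_ofReal_iff hB).1 h
  -- The uniform bound on the cardinality of finite subsets forces finiteness.
  have hfin : A.Finite := by
    by_contra hinf
    obtain ⟨n, hn⟩ := exists_nat_gt (B / y)
    obtain ⟨K, hKA, hKn⟩ := Set.Infinite.exists_subset_card_eq hinf n
    have := hcard K hKA
    rw [hKn] at this
    linarith
  refine ⟨hfin.toFinset, hcard _ (by simp), fun x hx hxy => ?_⟩
  rw [Set.Finite.mem_toFinset]
  exact ⟨x, hx, hxy, rfl⟩

/-- The `L^q`-flattening of the Fourier transform of a stationary measure. -/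
theorem exists_cellSum_measureFourier_le {ι : Type*} {φ : ι → ℝ → ℝ} {r t p : ι → ℝ}
    (hφ : ∀ a x, φ a x = r a * x + t a) {ρ τ : ℝ} (hρ1 : ρ < 1) (hr : ∀ a, 0 < |r a|)
    (hrρ : ∀ a, |r a| ≤ ρ) (hp : IsProbabilityVector p) (hτ : 0 < τ)
    (hpr : Summable fun a => p a * |r a| ^ (-τ)) {μ : Measure ℝ}
    (hμ : IsStationaryMeasure φ p μ) {a b : ι} (hab : a ≠ b)
    (hd : t a + r a * t b - (t b + r b * t a) ≠ 0) {γ : ℝ} (hγ : 0 < γ) :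
    ∃ q : ℕ, 1 ≤ q ∧ ∃ C : ℝ, 0 ≤ C ∧ ∀ T : ℝ, 1 ≤ T →
      cellSum (fun x => ENNReal.ofReal
        ‖measureFourier μ (x / (t a + r a * t b - (t b + r b * t a)))‖ ^ q) T
        ≤ ENNReal.ofReal (C * T ^ γ) := by
  classical
  have := hμ.1
  have hρ0 : 0 < ρ := (hr a).trans_le (hrρ a)
  have hne : (a, b) ≠ (b, a) := fun h => hab (congrArg Prod.fst h)
  have hratio : ∀ x : ι × ι, |r x.1 * r x.2| ≤ ρ := fun x => by
    rw [abs_mul]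
    exact (mul_le_of_le_one_right (abs_nonneg _) ((hrρ _).trans hρ1.le)).trans (hrρ _)
  have hratio0 : ∀ x : ι × ι, 0 < |r x.1 * r x.2| := fun x => by
    rw [abs_mul]; exact mul_pos (hr _) (hr _)
  have hpab : 0 < p a * p b := mul_pos (hp.1 _) (hp.1 _)
  have hprod : ∀ F : ι → ENNReal, ∑' x : ι × ι, F x.1 * F x.2 = (∑' a, F a) ^ 2 := fun F => by
    rw [ENNReal.tsum_prod', sq, ← ENNReal.tsum_mul_right]
    simp_rw [ENNReal.tsum_mul_left]
  have hcoe : ((({(a, b), (b, a)} : Finset (ι × ι)) : Set (ι × ι)))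
      = ({(a, b), (b, a)} : Set (ι × ι)) := by simp
  refine exists_cellSum_pow_le_of_renewal
    (fun x : ↥({(a, b), (b, a)} : Set (ι × ι))ᶜ => ENNReal.ofReal (p x.1.1 * p x.1.2))
    (fun x => |r x.1.1 * r x.1.2|) (ENNReal.ofReal (2 * (p a * p b))) hρ0 hρ1
    (fun x => hratio0 x.1) (fun x => hratio x.1) (hratio0 (a, b)) (hratio (a, b))
    (ENNReal.ofReal_pos.2 (by positivity)).ne' ?_ hτ ?_ _
    (fun x => ENNReal.ofReal_le_one.2 (norm_measureFourier_le_one μ _)) (fun x => ?_) hγ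
  · have h1 : ∑' x : ι × ι, ENNReal.ofReal (p x.1 * p x.2) = 1 := by
      simp_rw [fun x : ι × ι => ENNReal.ofReal_mul (q := p x.2) (hp.1 x.1).le]
      rw [hprod fun a => ENNReal.ofReal (p a),
        ← ENNReal.ofReal_tsum_of_nonneg (fun a => (hp.1 a).le) hp.2.summable, hp.2.tsum_eq]
      simp
    rw [← h1, ← ENNReal.sum_add_tsum_compl {(a, b), (b, a)}, Finset.sum_pair hne, hcoe,
      ← ENNReal.ofReal_add hpab.le (by rw [mul_comm]; exact hpab.le)]
    gcongr
    apply le_of_eq; ring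
  · refine ne_top_of_le_ne_top ?_ (ENNReal.tsum_comp_le_tsum_of_injective Subtype.val_injective
      fun x : ι × ι => ENNReal.ofReal (p x.1 * p x.2) *
        ENNReal.ofReal (|r x.1 * r x.2| ^ (-τ)))
    have h2 : ∀ x : ι × ι, ENNReal.ofReal (p x.1 * p x.2) *
        ENNReal.ofReal (|r x.1 * r x.2| ^ (-τ))
        = ENNReal.ofReal (p x.1 * |r x.1| ^ (-τ)) * ENNReal.ofReal (p x.2 * |r x.2| ^ (-τ)) :=
      fun x => by
        have := hp.1 x.1
        have := hp.1 x.2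
        rw [← ENNReal.ofReal_mul (by positivity), ← ENNReal.ofReal_mul (by positivity), abs_mul,
          Real.mul_rpow (abs_nonneg _) (abs_nonneg _)]
        congr 1; ring
    simp_rw [h2]
    rw [hprod fun a => ENNReal.ofReal (p a * |r a| ^ (-τ)), ← ENNReal.ofReal_tsum_of_nonneg
      (fun a => mul_nonneg (hp.1 a).le (Real.rpow_nonneg (abs_nonneg _) _)) hpr]
    exact ENNReal.pow_ne_top ENNReal.ofReal_ne_top
  -- Rescaling the frequency by `d` turns the interference factor into `cos (π * x)`.
  · have h := norm_measureFourier_le_pairs hφ hp.1 hp.2.summable hμ hab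
      (x / (t a + r a * t b - (t b + r b * t a)))
    rw [mul_div_cancel₀ x hd] at h
    simpa only [mul_div_assoc] using h

theorem corollaryc {ι : Type*} (φ : ι → ℝ → ℝ) (r t p : ι → ℝ)
    (hφ : IsCIFS φ)
    (hsim : ∀ a : ι, IsSimilarityWith (φ a) (r a) (t a))
    (hnt : IsNontrivialIFS φ)
    (hp : IsProbabilityVector p)
    (hτ : ∃ τ : ℝ, 0 < τ ∧ Summable (fun a : ι => p a * |r a| ^ (-τ)))
    (μ : Measure ℝ) (hμ : IsStationaryMeasure φ p μ) :
    ∀ γ : ℝ, 0 < γ → ∃ η C : ℝ, 0 < η ∧ 0 < C ∧ ∀ T : ℝ, 0 < T →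
      CoveredByUnitIntervals
        {ξ : ℝ | ξ ∈ Set.Icc (-T) T ∧ T ^ (-η) ≤ ‖measureFourier μ ξ‖}
        (C * T ^ γ) := by
  intro γ hγ
  have := hμ.1
  obtain ⟨τ, hτ0, hτs⟩ := hτ
  obtain ⟨-, ρ, hρ1, hρ⟩ := hφ
  have hφ' : ∀ a x, φ a x = r a * x + t a := fun a => (hsim a).2.2
  have hrρ : ∀ a, |r a| ≤ ρ := fun a => by simpa [hφ'] using hρ a 1 0
  obtain ⟨a, b, hab, hd⟩ := hnt.exists_not_commute hφ' fun a => (hsim a).2.1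
  obtain ⟨q, hq, C, hC, hcell⟩ := exists_cellSum_measureFourier_le hφ' hρ1 (fun a => (hsim a).1)
    hrρ hp hτ0 hτs hμ hab hd (half_pos hγ)
  set d : ℝ := t a + r a * t b - (t b + r b * t a) with hd_def
  -- The maximum with `1` keeps `D * T ≥ 1`, as the cell-sum bound requires, while `|d * ξ| ≤ D *
  -- T`.
  set D : ℝ := max 1 |d| with hD
  have hD1 : 1 ≤ D := le_max_left _ _
  have hq0 : (0 : ℝ) < q := by exact_mod_cast hq
  -- The exponent `γ` is split evenly: `T ^ (γ / 2)` from the cell sum and `T ^ (η * q) = T ^ (γ /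
  -- 2)` from Markov's inequality. The `+ 1` keeps the constant positive when `C = 0`.
  refine ⟨γ / 2 / q, C * D ^ (γ / 2) * (⌊1 / |d|⌋₊ + 1) + 1, by positivity, by positivity, ?_⟩
  intro T hT
  -- For `T < 1` the threshold `T ^ (-η)` exceeds `1`, so the set is empty.
  rcases lt_or_ge T 1 with hT1 | hT1
  · refine ⟨∅, by simp only [Finset.card_empty, Nat.cast_zero]; positivity, ?_⟩
    rintro ξ ⟨-, hξ⟩
    have h1 : 1 < T ^ (-(γ / 2 / q)) :=
      Real.one_lt_rpow_of_pos_of_lt_one_of_neg hT hT1 (neg_lt_zero.2 (by positivity))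
    linarith [norm_measureFourier_le_one μ ξ]
  · have hDT : 1 ≤ D * T := by nlinarith
    obtain ⟨K, hKcard, hK⟩ := exists_finset_round_mem (y := T ^ (-(γ / 2))) (by positivity)
      (by positivity) (hcell (D * T) hDT)
    refine coveredByUnitIntervals_of_round hd K (fun ξ hξ => hK _ ?_ ?_) ?_
    · rw [abs_mul]
      gcongr
      · exact le_max_right _ _
      · exact abs_le.2 hξ.1
    · rw [mul_div_cancel_left₀ ξ hd, ← ENNReal.ofReal_pow (norm_nonneg _)]
      apply ENNReal.ofReal_le_ofReal
      calc T ^ (-(γ / 2)) = (T ^ (-(γ / 2 / q))) ^ q := by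
            rw [← Real.rpow_natCast, ← Real.rpow_mul hT.le]
            congr 1; field_simp
        _ ≤ _ := by gcongr; exact hξ.2
    · have e : C * (D * T) ^ (γ / 2) / T ^ (-(γ / 2)) = C * D ^ (γ / 2) * T ^ γ := by
        rw [Real.mul_rpow (by positivity) hT.le, Real.rpow_neg hT.le, div_inv_eq_mul]
        have : T ^ γ = T ^ (γ / 2) * T ^ (γ / 2) := by
          rw [← Real.rpow_add hT]; congr 1; ring
        rw [this]; ring
      rw [e] at hKcard
      calc (K.card : ℝ) * (⌊1 / |d|⌋₊ + 1)
          ≤ C * D ^ (γ / 2) * T ^ γ * (⌊1 / |d|⌋₊ + 1) := by gcongr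
        _ = C * D ^ (γ / 2) * (⌊1 / |d|⌋₊ + 1) * T ^ γ := by ring
        _ ≤ _ := by gcongr; linarith
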